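/- Let $\mathbb{R}[x,y]_d$ be the real vector space of binary forms of degree $d$, with the Euclidean topology obtained by identifying a form with its vector of coefficients in $\mathbb{R}^{d+1}$. The real Waring rank of $f\in\mathbb{R}[x,y]_d$ is the least integer $r\ge 0$ such that $f=\sum_{i=1}^r c_i\ell_i^d$ for some $c_1,\dots,c_r\in\mathbb{R}$ and some real linear forms $\ell_1,\dots,\ell_r\in\mathbb{R}[x,y]_1$. An integer $m$ is called a typical rank for forms in $\mathbb{R}[x,y]_d$ if there is a form $f\in\mathbb{R}[x,y]_d$ of real Waring rank $m$ such that all forms in some open neighbourhood of $f$ in $\mathbb{R}[x,y]_d$ also have real Waring rank $m$. Theorem. For every degree $d$, all integers $m$ with $\lfloor\frac{d+2}{2}\rfloor\le m\le d$ are typical ranks for forms in $\mathbb{R}[x,y]_d$. -/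

import Mathlib

/-- Real binary forms of degree `d`: the space `ℝ[x, y]_d` (with `x = X 0`, `y = X 1`). -/
abbrev RealBinaryForm (d : ℕ) : Type :=
  ↥(MvPolynomial.homogeneousSubmodule (Fin 2) ℝ d)

/-- The coefficient vector `(a₀, …, a_d)` of a form `f = ∑ i, a_i x ^ i y ^ (d - i)`. -/
noncomputable def RealBinaryForm.coeffVec {d : ℕ} (f : RealBinaryForm d) : Fin (d + 1) → ℝ :=
  fun i => MvPolynomial.coeff
    (Finsupp.single (0 : Fin 2) (i : ℕ) + Finsupp.single (1 : Fin 2) (d - (i : ℕ)))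
    (f : MvPolynomial (Fin 2) ℝ)

/-- The Euclidean topology on `ℝ[x, y]_d`, a form being viewed as its vector of coefficients
in `ℝ ^ (d + 1)` (on which the product topology is the Euclidean one). -/
noncomputable instance RealBinaryForm.euclideanTopology (d : ℕ) :
    TopologicalSpace (RealBinaryForm d) :=
  TopologicalSpace.induced RealBinaryForm.coeffVec inferInstance

/-- `f` is a real linear combination of `r` many `d`-th powers of real linear forms. -/
def RealBinaryForm.HasWaringDecomposition {d : ℕ} (f : RealBinaryForm d) (r : ℕ) : Prop :=
  ∃ (c : Fin r → ℝ) (l : Fin r → RealBinaryForm 1),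
    (f : MvPolynomial (Fin 2) ℝ) =
      ∑ i, MvPolynomial.C (c i) * (l i : MvPolynomial (Fin 2) ℝ) ^ d

/-- The real Waring rank of `f` is `m`: `f` is a linear combination of `m` many `d`-th powers of
real linear forms and of no fewer. -/
def RealBinaryForm.HasRealRank {d : ℕ} (f : RealBinaryForm d) (m : ℕ) : Prop :=
  IsLeast {r : ℕ | f.HasWaringDecomposition r} m

/-- `m` is a typical rank for real binary forms of degree `d`: some form `f` of degree `d` has
real rank `m`, and so do all forms in an open neighbourhood of `f`. -/
def IsTypicalRealRank (d m : ℕ) : Prop :=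
  ∃ f : RealBinaryForm d, f.HasRealRank m ∧
    ∃ U : Set (RealBinaryForm d), IsOpen U ∧ f ∈ U ∧ ∀ g ∈ U, g.HasRealRank m

/-!
Let `S r` be the set of forms that are linear combinations of `r` many `d`-th powers, identified
throughout with sets of coefficient vectors (`powSums d r`), and write `m = r + 1`. A form in the
interior of `S m` and outside the closure of `S r` has rank `m` together with all nearby forms
(`isTypicalRealRank_of_mem_interior`), so one such form is wanted. It exists for three reasons.

* `S m` is not contained in the closure of `S r`. Otherwise the closure of `S r` would be stable
  under adding multiples of powers, hence would be the whole space, because powers span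
  (`closure_powSums_eq_univ`). But the real part of `(y - i x) ^ d` stays at a positive distance
  from `S r` as soon as `r < d` (`exists_notMem_closure_powSums`): the directional derivatives along
  the zeros of the `r` linear forms kill any element of `S r`, have bounded norm once the directions
  are normalized, and turn `(y - i x) ^ d` into a complex multiple, of modulus bounded below, of
  `(y - i x) ^ (d - r)`, whose real part is not close to zero because `d - r` is positive.
* A form `∑ c i • l i ^ d` in `S m` but not in `S r` has nonzero `c i` and pairwise independent
  `l i`, as otherwise two terms could be merged or one dropped
  (`nondegenerate_of_notMem_powSums`).
* At such a representation the parametrization of sums of `m` powers by the linear forms is a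
  submersion when `d < 2 m`, which is the lower bound on `m`; so the form is interior to `S m`
  (`mem_interior_powSums`). A functional vanishing on the image of the derivative is a polynomial
  of degree at most `d` with `m` double roots on the projective line, hence zero.
-/

/-! ### Coefficient vectors of sums of powers -/

/-- The coefficient vector of `(a x + b y) ^ d`. -/
def powVec (d : ℕ) (a b : ℝ) : Fin (d + 1) → ℝ :=
  fun k => (d.choose k : ℝ) * (a ^ (k : ℕ) * b ^ (d - (k : ℕ)))

/-- The coefficient vectors of the linear combinations of `r` many `d`-th powers of linear
forms. -/
def powSums (d r : ℕ) : Set (Fin (d + 1) → ℝ) :=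
  {v | ∃ c a b : Fin r → ℝ, v = ∑ i, c i • powVec d (a i) (b i)}

lemma powVec_smul (d : ℕ) (s a b : ℝ) : powVec d (s * a) (s * b) = s ^ d • powVec d a b := by
  ext k
  have hk : s ^ d = s ^ (k : ℕ) * s ^ (d - (k : ℕ)) := by
    rw [← pow_add]; congr 1; have := k.2; omega
  simp only [powVec, Pi.smul_apply, smul_eq_mul, mul_pow, hk]
  ring

lemma zero_mem_powSums (d r : ℕ) : (0 : Fin (d + 1) → ℝ) ∈ powSums d r :=
  ⟨0, 0, 0, by simp⟩

lemma add_mem_powSums {d r : ℕ} {v : Fin (d + 1) → ℝ} (hv : v ∈ powSums d r) (c a b : ℝ) :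
    c • powVec d a b + v ∈ powSums d (r + 1) := by
  obtain ⟨c', a', b', rfl⟩ := hv
  exact ⟨Fin.cons c c', Fin.cons a a', Fin.cons b b', by simp [Fin.sum_univ_succ]⟩

lemma powSums_mono (d : ℕ) : Monotone (powSums d) := by
  refine monotone_nat_of_le_succ fun r v hv => ?_
  simpa using add_mem_powSums hv 0 0 0

/-- In a sum of `r + 1` powers which is not a sum of `r` powers, no coefficient and no
linear form vanishes, and no two of the linear forms are proportional. -/
lemma nondegenerate_of_notMem_powSums {d r : ℕ} (hd : d ≠ 0) {c a b : Fin (r + 1) → ℝ}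
    (h : ∑ i, c i • powVec d (a i) (b i) ∉ powSums d r) :
    (∀ i, c i ≠ 0) ∧ (∀ i, a i ≠ 0 ∨ b i ≠ 0) ∧ ∀ i j, i ≠ j → a i * b j ≠ a j * b i := by
  -- A term that is a multiple of another one can be absorbed by changing a coefficient.
  have key : ∀ i (j : Fin r) (s : ℝ), c i • powVec d (a i) (b i) ≠
      s • powVec d (a (i.succAbove j)) (b (i.succAbove j)) := by
    intro i j s hs
    apply h
    refine ⟨fun k => c (i.succAbove k) + if k = j then s else 0, fun k => a (i.succAbove k),
      fun k => b (i.succAbove k), ?_⟩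
    rw [Fin.sum_univ_succAbove _ i, hs]
    simp [add_smul, Finset.sum_add_distrib, add_comm]
  have key0 : ∀ i, c i • powVec d (a i) (b i) ≠ 0 := by
    intro i hi
    apply h
    rw [Fin.sum_univ_succAbove _ i, hi, zero_add]
    exact ⟨_, _, _, rfl⟩
  have hne : ∀ i, a i ≠ 0 ∨ b i ≠ 0 := by
    intro i
    by_contra! h
    apply key0 i
    have := powVec_smul d 0 0 0
    simp only [mul_zero, zero_pow hd, zero_smul] at this
    rw [h.1, h.2, this, smul_zero]
  refine ⟨fun i hi => key0 i (by simp [hi]), hne, fun i j hij hdet => ?_⟩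
  obtain ⟨s, hs1, hs2⟩ : ∃ s : ℝ, a i = s * a j ∧ b i = s * b j := by
    by_cases ha : a j = 0
    · have hb : b j ≠ 0 := (hne j).resolve_left (not_not_intro ha)
      refine ⟨b i / b j, ?_, by field_simp⟩
      have : a i * b j = 0 := by rw [hdet, ha, zero_mul]
      simp [ha, (mul_eq_zero.1 this).resolve_right hb]
    · refine ⟨a i / a j, by field_simp, ?_⟩
      field_simp
      linarith
  obtain ⟨k, rfl⟩ := Fin.exists_succAbove_eq hij.symm
  apply key i k (c i * s ^ d)
  rw [hs1, hs2, powVec_smul, smul_smul]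

/-! ### Binary forms and their coefficient vectors -/

/-- The exponent of `x ^ i y ^ (d - i)`. -/
noncomputable abbrev binaryExp (d i : ℕ) : Fin 2 →₀ ℕ :=
  Finsupp.single (0 : Fin 2) i + Finsupp.single (1 : Fin 2) (d - i)

lemma binaryExp_inj {d i j : ℕ} : binaryExp d i = binaryExp d j ↔ i = j := by
  refine ⟨fun h => ?_, fun h => by rw [h]⟩
  simpa [binaryExp] using DFunLike.congr_fun h 0

lemma RealBinaryForm.coeffVec_injective (d : ℕ) :
    Function.Injective (RealBinaryForm.coeffVec (d := d)) := by
  intro f g h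
  apply Subtype.ext
  ext m
  by_cases hm : m.degree = d
  · have h2 : m 0 + m 1 = d := by
      rw [← hm, Finsupp.degree_eq_sum, Fin.sum_univ_two]
    have h3 : m = binaryExp d (m 0) := by
      ext i
      fin_cases i
      · simp [binaryExp]
      · simp [binaryExp]; omega
    have := congrFun h ⟨m 0, by omega⟩
    rw [h3]
    exact this
  · have hf := (MvPolynomial.mem_homogeneousSubmodule d f.1).1 f.2
    have hg := (MvPolynomial.mem_homogeneousSubmodule d g.1).1 g.2
    rw [hf.coeff_eq_zero hm, hg.coeff_eq_zero hm]

/-- The binary form with a given coefficient vector. -/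
noncomputable def RealBinaryForm.ofVec {d : ℕ} (v : Fin (d + 1) → ℝ) : RealBinaryForm d :=
  ⟨∑ i : Fin (d + 1), MvPolynomial.monomial (binaryExp d i) (v i), by
    refine Submodule.sum_mem _ fun i _ => ?_
    rw [MvPolynomial.mem_homogeneousSubmodule]
    apply MvPolynomial.isHomogeneous_monomial
    have := i.2
    rw [binaryExp, map_add, Finsupp.degree_single, Finsupp.degree_single]
    omega⟩

lemma RealBinaryForm.coeffVec_ofVec {d : ℕ} (v : Fin (d + 1) → ℝ) :
    (RealBinaryForm.ofVec v).coeffVec = v := by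
  ext i
  simp only [RealBinaryForm.coeffVec, RealBinaryForm.ofVec, MvPolynomial.coeff_sum,
    MvPolynomial.coeff_monomial, binaryExp_inj, Fin.val_inj]
  simp

lemma RealBinaryForm.ofVec_coeffVec {d : ℕ} (f : RealBinaryForm d) :
    RealBinaryForm.ofVec f.coeffVec = f :=
  RealBinaryForm.coeffVec_injective d (RealBinaryForm.coeffVec_ofVec _)

lemma RealBinaryForm.ofVec_powVec (d : ℕ) (a b : ℝ) :
    (RealBinaryForm.ofVec (powVec d a b) : MvPolynomial (Fin 2) ℝ) =
      (MvPolynomial.C a * MvPolynomial.X 0 + MvPolynomial.C b * MvPolynomial.X 1) ^ d := by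
  rw [add_pow, Finset.sum_range, RealBinaryForm.ofVec]
  dsimp only
  refine Finset.sum_congr rfl fun k _ => ?_
  have hC : ((d.choose k : ℕ) : MvPolynomial (Fin 2) ℝ) = MvPolynomial.C (d.choose k : ℝ) := by
    simp
  rw [hC, powVec, MvPolynomial.monomial_eq]
  simp only [mul_pow, map_mul, map_pow]
  have hX : (binaryExp d k).prod (fun i e => (MvPolynomial.X i : MvPolynomial (Fin 2) ℝ) ^ e) =
      MvPolynomial.X 0 ^ (k : ℕ) * MvPolynomial.X 1 ^ (d - (k : ℕ)) := by
    rw [binaryExp, Finsupp.prod_add_index' (fun _ => pow_zero _) (fun _ _ _ => pow_add _ _ _)]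
    simp
  rw [hX]
  ring

lemma RealBinaryForm.hasWaringDecomposition_iff {d : ℕ} (f : RealBinaryForm d) (r : ℕ) :
    f.HasWaringDecomposition r ↔ f.coeffVec ∈ powSums d r := by
  have hsum : ∀ c a b : Fin r → ℝ,
      (RealBinaryForm.ofVec (∑ i, c i • powVec d (a i) (b i)) : MvPolynomial (Fin 2) ℝ) =
      ∑ i, MvPolynomial.C (c i) *
        (MvPolynomial.C (a i) * MvPolynomial.X 0 +
          MvPolynomial.C (b i) * MvPolynomial.X 1) ^ d := by
    intro c a b
    simp only [← RealBinaryForm.ofVec_powVec, RealBinaryForm.ofVec, Finset.mul_sum,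
      MvPolynomial.C_mul_monomial]
    rw [Finset.sum_comm]
    refine Finset.sum_congr rfl fun k _ => ?_
    rw [← map_sum]
    simp
  constructor
  · rintro ⟨c, l, h⟩
    refine ⟨c, fun i => (l i).coeffVec 1, fun i => (l i).coeffVec 0, ?_⟩
    have hl : ∀ i, (l i : MvPolynomial (Fin 2) ℝ) =
        MvPolynomial.C ((l i).coeffVec 1) * MvPolynomial.X 0 +
          MvPolynomial.C ((l i).coeffVec 0) * MvPolynomial.X 1 := by
      intro i
      have h1 : powVec 1 ((l i).coeffVec 1) ((l i).coeffVec 0) = (l i).coeffVec := by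
        ext k
        fin_cases k <;> simp [powVec]
      have := RealBinaryForm.ofVec_powVec 1 ((l i).coeffVec 1) ((l i).coeffVec 0)
      rwa [h1, RealBinaryForm.ofVec_coeffVec, pow_one] at this
    have hf : f = RealBinaryForm.ofVec
        (∑ i, c i • powVec d ((l i).coeffVec 1) ((l i).coeffVec 0)) := by
      apply Subtype.ext
      rw [hsum, h]
      exact Finset.sum_congr rfl fun i _ => by rw [← hl]
    conv_lhs => rw [hf, RealBinaryForm.coeffVec_ofVec]
  · rintro ⟨c, a, b, h⟩
    refine ⟨c, fun i => RealBinaryForm.ofVec (powVec 1 (a i) (b i)), ?_⟩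
    conv_lhs => rw [← RealBinaryForm.ofVec_coeffVec f, h, hsum]
    simp only [RealBinaryForm.ofVec_powVec, pow_one]

/-- A vector in the interior of the sums of `r + 1` powers which is not a limit of sums of `r`
powers witnesses that `r + 1` is a typical rank. -/
lemma isTypicalRealRank_of_mem_interior {d r : ℕ} {v : Fin (d + 1) → ℝ}
    (h1 : v ∈ interior (powSums d (r + 1))) (h2 : v ∉ closure (powSums d r)) :
    IsTypicalRealRank d (r + 1) := by
  have hrank : ∀ g : RealBinaryForm d,
      g.coeffVec ∈ interior (powSums d (r + 1)) ∩ (closure (powSums d r))ᶜ →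
        g.HasRealRank (r + 1) := by
    rintro g ⟨hg1, hg2⟩
    refine ⟨(g.hasWaringDecomposition_iff _).2 (interior_subset hg1), fun k hk => ?_⟩
    by_contra! hlt
    exact hg2 (subset_closure
      (powSums_mono d (Nat.lt_succ_iff.1 hlt) ((g.hasWaringDecomposition_iff k).1 hk)))
  have hv : (RealBinaryForm.ofVec v).coeffVec ∈
      interior (powSums d (r + 1)) ∩ (closure (powSums d r))ᶜ := by
    rw [RealBinaryForm.coeffVec_ofVec]; exact ⟨h1, h2⟩
  exact ⟨RealBinaryForm.ofVec v, hrank _ hv,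
    RealBinaryForm.coeffVec ⁻¹' (interior (powSums d (r + 1)) ∩ (closure (powSums d r))ᶜ),
    isOpen_induced (isOpen_interior.inter isClosed_closure.isOpen_compl), hv, hrank⟩

/-! ### A form that is not a limit of sums of `d - 1` powers -/

/-- The sequence `k ↦ Re (z (-i) ^ k)` stays at a fixed distance from all sums of `r` sequences
`k ↦ c a ^ k b ^ (n - k)` once `r < n`. The operator `w ↦ (k ↦ b w (k + 1) - a w k)` with
`a ^ 2 + b ^ 2 = 1` kills the term of `(a, b)`, keeps the shape of the other terms and of the
given sequence, and at most doubles the maximum norm. -/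
lemma exists_le_abs_re_sub_sum (r : ℕ) : ∀ (n : ℕ), r < n → ∀ (c a b : Fin r → ℝ) (z : ℂ),
    ‖z‖ = 1 → ∃ k ≤ n, (1 / 2) ^ (r + 1) ≤
      |(z * (-Complex.I) ^ k).re - ∑ i, c i * (a i ^ k * b i ^ (n - k))| := by
  induction r with
  | zero =>
    intro n hn c a b z hz
    have h1 : z.re * z.re + z.im * z.im = 1 := by
      rw [← Complex.normSq_apply, Complex.normSq_eq_norm_sq, hz, one_pow]
    by_contra! hcon
    have h0 := hcon 0 (Nat.zero_le _)
    have h2 := hcon 1 hn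
    simp at h0 h2
    rw [abs_lt] at h0 h2
    nlinarith
  | succ r ih =>
    intro n hn c a b z hz
    -- A unit vector `(α, β)` proportional to the last linear form.
    obtain ⟨α, β, hαβ, hdet⟩ : ∃ α β : ℝ, α ^ 2 + β ^ 2 = 1 ∧ β * a 0 = α * b 0 := by
      by_cases h : a 0 = 0 ∧ b 0 = 0
      · exact ⟨1, 0, by norm_num, by simp [h.1, h.2]⟩
      · have hpos : 0 < a 0 ^ 2 + b 0 ^ 2 := by
          rcases not_and_or.1 h with h | h
          · have := pow_pos (abs_pos.2 h) 2; rw [sq_abs] at this; positivity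
          · have := pow_pos (abs_pos.2 h) 2; rw [sq_abs] at this; positivity
        have hs := Real.sqrt_pos.2 hpos
        refine ⟨a 0 / √(a 0 ^ 2 + b 0 ^ 2), b 0 / √(a 0 ^ 2 + b 0 ^ 2), ?_, by ring⟩
        rw [div_pow, div_pow, Real.sq_sqrt hpos.le, ← add_div, div_self hpos.ne']
    have hα : |α| ≤ 1 := abs_le_one_iff_mul_self_le_one.2 (by nlinarith [sq_nonneg β])
    have hβ : |β| ≤ 1 := abs_le_one_iff_mul_self_le_one.2 (by nlinarith [sq_nonneg α])
    have hz' : ‖z * (β * (-Complex.I) - α)‖ = 1 := by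
      rw [norm_mul, hz, one_mul]
      have : ‖(β * (-Complex.I) - α : ℂ)‖ ^ 2 = 1 := by
        rw [← Complex.normSq_eq_norm_sq, Complex.normSq_apply]
        simp
        linarith
      exact (pow_eq_one_iff_of_nonneg (norm_nonneg _) two_ne_zero).1 this
    obtain ⟨k, hk, hle⟩ := ih (n - 1) (by omega)
      (fun i => c i.succ * (β * a i.succ - α * b i.succ))
      (fun i => a i.succ) (fun i => b i.succ) _ hz'
    set x : ℕ → ℝ := fun k =>
      (z * (-Complex.I) ^ k).re - ∑ i, c i * (a i ^ k * b i ^ (n - k)) with hx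
    have hn1 : n - k = (n - 1 - k) + 1 := by omega
    have hn2 : n - (k + 1) = n - 1 - k := by omega
    have hrec : (z * (β * (-Complex.I) - α) * (-Complex.I) ^ k).re -
        ∑ i : Fin r, c i.succ * (β * a i.succ - α * b i.succ) *
          (a i.succ ^ k * b i.succ ^ (n - 1 - k)) = β * x (k + 1) - α * x k := by
      have e1 : (z * (β * (-Complex.I) - α) * (-Complex.I) ^ k).re =
          β * (z * (-Complex.I) ^ (k + 1)).re - α * (z * (-Complex.I) ^ k).re := by
        rw [← Complex.re_ofReal_mul, ← Complex.re_ofReal_mul, ← Complex.sub_re]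
        congr 1
        ring
      have e2 : ∑ i : Fin r, c i.succ * (β * a i.succ - α * b i.succ) *
          (a i.succ ^ k * b i.succ ^ (n - 1 - k)) =
          β * ∑ i, c i * (a i ^ (k + 1) * b i ^ (n - (k + 1))) -
            α * ∑ i, c i * (a i ^ k * b i ^ (n - k)) := by
        rw [Finset.mul_sum, Finset.mul_sum, ← Finset.sum_sub_distrib, Fin.sum_univ_succ, hn1, hn2]
        have e3 : β * (c 0 * (a 0 ^ (k + 1) * b 0 ^ (n - 1 - k))) -
            α * (c 0 * (a 0 ^ k * b 0 ^ (n - 1 - k + 1))) = 0 := by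
          linear_combination c 0 * a 0 ^ k * b 0 ^ (n - 1 - k) * hdet
        rw [e3, zero_add]
        exact Finset.sum_congr rfl fun i _ => by ring
      rw [e1, e2, hx]
      ring
    rw [hrec] at hle
    by_contra! hcon
    have h1 := hcon k (by omega)
    have h2 := hcon (k + 1) (by omega)
    have h3 : |β * x (k + 1) - α * x k| ≤ |x (k + 1)| + |x k| := by
      refine (abs_sub _ _).trans ?_
      rw [abs_mul, abs_mul]
      gcongr
      · exact mul_le_of_le_one_left (abs_nonneg _) hβ
      · exact mul_le_of_le_one_left (abs_nonneg _) hα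
    change |x k| < _ at h1
    change |x (k + 1)| < _ at h2
    rw [pow_succ] at h1 h2
    linarith

/-- The coefficient vector of the real part of `(y - i x) ^ d` is not a limit of sums of fewer than
`d` powers. -/
lemma exists_notMem_closure_powSums {d r : ℕ} (hr : r < d) :
    ∃ v : Fin (d + 1) → ℝ, v ∉ closure (powSums d r) := by
  refine ⟨fun k => d.choose k * ((-Complex.I) ^ (k : ℕ)).re, fun hv => ?_⟩
  obtain ⟨w, ⟨c, a, b, rfl⟩, hw⟩ := Metric.mem_closure_iff.1 hv ((1 / 2) ^ (r + 1)) (by positivity)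
  obtain ⟨k, hk, hle⟩ := exists_le_abs_re_sub_sum r d hr c a b 1 (by simp)
  have h1 := (dist_le_pi_dist _ _ (⟨k, by omega⟩ : Fin (d + 1))).trans_lt hw
  have h2 : (1 : ℝ) ≤ d.choose k := by exact_mod_cast Nat.choose_pos hk
  have h3 : (d.choose k * ((-Complex.I) ^ k).re -
      (∑ i, c i • powVec d (a i) (b i)) ⟨k, by omega⟩) = d.choose k *
        ((1 * (-Complex.I) ^ k).re - ∑ i, c i * (a i ^ k * b i ^ (d - k))) := by
    simp only [Finset.sum_apply, Pi.smul_apply, powVec, smul_eq_mul, mul_sub, Finset.mul_sum,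
      one_mul]
    congr 1
    exact Finset.sum_congr rfl fun i _ => by ring
  rw [Real.dist_eq] at h1
  simp only [h3, abs_mul, Nat.abs_cast] at h1
  exact absurd (hle.trans (le_mul_of_one_le_left (abs_nonneg _) h2)) (not_le.2 h1)

/-! ### Functionals as polynomials, and density of sums of powers -/

lemma exists_dual_coeffs {n : ℕ} (φ : (Fin n → ℝ) →ₗ[ℝ] ℝ) :
    ∃ μ : Fin n → ℝ, ∀ v, φ v = ∑ k, μ k * v k := by
  refine ⟨fun k => φ (Pi.single k 1), fun v => ?_⟩
  conv_lhs => rw [pi_eq_sum_univ' v, map_sum]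
  refine Finset.sum_congr rfl fun k _ => ?_
  rw [map_smul, smul_eq_mul, mul_comm]

/-- The polynomial `t ↦ ∑ k, μ k * powVec d t 1 k`: the functional with coefficients `μ`, evaluated
at the power `(t x + y) ^ d`. It is the dehomogenization at `b = 1` of the binary form
`(a, b) ↦ ∑ k, μ k * powVec d a b k` dual to `μ` under the apolar pairing. -/
noncomputable def dualPoly {d : ℕ} (μ : Fin (d + 1) → ℝ) : Polynomial ℝ :=
  ∑ k : Fin (d + 1), Polynomial.C (μ k * d.choose k) * Polynomial.X ^ (k : ℕ)

lemma coeff_dualPoly {d : ℕ} (μ : Fin (d + 1) → ℝ) (k : Fin (d + 1)) :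
    (dualPoly μ).coeff k = μ k * d.choose k := by
  simp only [dualPoly, Polynomial.finsetSum_coeff, Polynomial.coeff_C_mul, Polynomial.coeff_X_pow,
    Fin.val_inj]
  simp

lemma natDegree_dualPoly_le {d : ℕ} (μ : Fin (d + 1) → ℝ) : (dualPoly μ).natDegree ≤ d :=
  Polynomial.natDegree_sum_le_of_forall_le _ _ fun k _ =>
    (Polynomial.natDegree_C_mul_X_pow_le _ _).trans (Nat.lt_succ_iff.1 k.2)

lemma eq_zero_of_dualPoly_eq_zero {d : ℕ} {μ : Fin (d + 1) → ℝ} (h : dualPoly μ = 0) : μ = 0 := by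
  ext k
  have := coeff_dualPoly μ k
  rw [h, Polynomial.coeff_zero, eq_comm, mul_eq_zero] at this
  exact this.resolve_right (Nat.cast_ne_zero.2 (Nat.choose_pos (Nat.lt_succ_iff.1 k.2)).ne')

lemma span_range_powVec (d : ℕ) :
    Submodule.span ℝ (Set.range fun p : ℝ × ℝ => powVec d p.1 p.2) = ⊤ := by
  by_contra hne
  obtain ⟨φ, hφ, hker⟩ := Submodule.exists_le_ker_of_lt_top _ (lt_top_iff_ne_top.2 hne)
  obtain ⟨μ, hμ⟩ := exists_dual_coeffs φ
  have hP : dualPoly μ = 0 := by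
    refine Polynomial.funext fun t => ?_
    have h1 : φ (powVec d t 1) = 0 := hker (Submodule.subset_span ⟨(t, 1), rfl⟩)
    rw [hμ] at h1
    rw [Polynomial.eval_zero, ← h1, dualPoly, Polynomial.eval_finsetSum]
    exact Finset.sum_congr rfl fun k _ => by simp [powVec]; ring
  apply hφ
  exact LinearMap.ext fun v => by simp [hμ, eq_zero_of_dualPoly_eq_zero hP]

/-- If every sum of `r + 1` powers is a limit of sums of `r` powers, then so is every vector. -/
lemma closure_powSums_eq_univ {d r : ℕ} (h : powSums d (r + 1) ⊆ closure (powSums d r)) :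
    closure (powSums d r) = Set.univ := by
  have hadd : ∀ c a b : ℝ, ∀ v ∈ closure (powSums d r),
      c • powVec d a b + v ∈ closure (powSums d r) := by
    intro c a b v hv
    have hmaps : Set.MapsTo (fun w => c • powVec d a b + w) (powSums d r) (powSums d (r + 1)) :=
      fun w hw => add_mem_powSums hw c a b
    exact closure_minimal h isClosed_closure (hmaps.closure (by fun_prop) hv)
  refine Set.eq_univ_of_forall fun v => ?_
  have hv : v ∈ Submodule.span ℝ (Set.range fun p : ℝ × ℝ => powVec d p.1 p.2) := by
    rw [span_range_powVec]; trivial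
  obtain ⟨n, f, g, rfl⟩ := Submodule.mem_span_set'.1 hv
  induction (Finset.univ : Finset (Fin n)) using Finset.induction_on with
  | empty => exact subset_closure (by simpa using zero_mem_powSums d r)
  | insert i s hi ih =>
    rw [Finset.sum_insert hi]
    obtain ⟨p, hp⟩ := (g i).2
    rw [← hp]
    exact hadd _ _ _ _ ih

/-! ### Openness of the sums of powers at points of exact rank -/

/-- The derivative of `(a, b) ↦ powVec d a b`. -/
noncomputable def powVecDeriv (d : ℕ) (a b : ℝ) : ℝ × ℝ →L[ℝ] Fin (d + 1) → ℝ :=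
  ContinuousLinearMap.pi fun k =>
    ((d.choose k : ℝ) * ((k : ℕ) * a ^ ((k : ℕ) - 1) * b ^ (d - (k : ℕ)))) •
        ContinuousLinearMap.fst ℝ ℝ ℝ +
      ((d.choose k : ℝ) * (a ^ (k : ℕ) * ((d - (k : ℕ) : ℕ) * b ^ (d - (k : ℕ) - 1)))) •
        ContinuousLinearMap.snd ℝ ℝ ℝ

lemma hasStrictFDerivAt_powVec (d : ℕ) (p : ℝ × ℝ) :
    HasStrictFDerivAt (fun q : ℝ × ℝ => powVec d q.1 q.2) (powVecDeriv d p.1 p.2) p := by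
  rw [hasStrictFDerivAt_pi']
  intro k
  have h1 : HasStrictFDerivAt (fun q : ℝ × ℝ => q.1 ^ (k : ℕ))
      (((k : ℕ) * p.1 ^ ((k : ℕ) - 1)) • ContinuousLinearMap.fst ℝ ℝ ℝ) p :=
    (hasStrictDerivAt_pow (k : ℕ) p.1).comp_hasStrictFDerivAt p hasStrictFDerivAt_fst
  have h2 : HasStrictFDerivAt (fun q : ℝ × ℝ => q.2 ^ (d - (k : ℕ)))
      (((d - (k : ℕ) : ℕ) * p.2 ^ (d - (k : ℕ) - 1)) • ContinuousLinearMap.snd ℝ ℝ ℝ) p :=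
    (hasStrictDerivAt_pow (d - (k : ℕ)) p.2).comp_hasStrictFDerivAt p hasStrictFDerivAt_snd
  refine ((h1.mul h2).const_mul (d.choose k : ℝ)).congr_fderiv ?_
  ext
  · simp [powVecDeriv, -mul_eq_mul_left_iff]
    ring
  · simp [powVecDeriv]

/-- The tangent spaces to the cone of `d`-th powers at `m` pairwise independent linear forms
together span everything when `d < 2 m`. In dual terms: a functional `μ` vanishing on all of them
is zero, since each linear form with `b i ≠ 0` is a double root of `dualPoly μ`, and the at most
one form with `b i = 0` lowers the degree of `dualPoly μ` to `d - 2`. -/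
lemma eq_zero_of_sum_mul_powVecDeriv_eq_zero {d m : ℕ} (hm : d < 2 * m) {a b : Fin m → ℝ}
    (hab : ∀ i j, i ≠ j → a i * b j ≠ a j * b i) {μ : Fin (d + 1) → ℝ}
    (hμ : ∀ i x, ∑ k, μ k * powVecDeriv d (a i) (b i) x k = 0)
    (hd : d ≠ 0) (h0 : ∀ i, a i ≠ 0 ∨ b i ≠ 0) : μ = 0 := by
  apply eq_zero_of_dualPoly_eq_zero
  have hx : ∀ i, ∑ k : Fin (d + 1), μ k * (d.choose k *
      ((k : ℕ) * a i ^ ((k : ℕ) - 1) * b i ^ (d - (k : ℕ)))) = 0 := by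
    intro i; simpa [powVecDeriv] using hμ i (1, 0)
  have hy : ∀ i, ∑ k : Fin (d + 1), μ k * (d.choose k *
      (a i ^ (k : ℕ) * ((d - (k : ℕ) : ℕ) * b i ^ (d - (k : ℕ) - 1)))) = 0 := by
    intro i; simpa [powVecDeriv] using hμ i (0, 1)
  -- The ratios `a i / b i` of the vectors in the affine chart are double roots.
  have hroot : ∀ i, b i ≠ 0 → dualPoly μ ≠ 0 → 2 ≤ (dualPoly μ).rootMultiplicity (a i / b i) := by
    intro i hi hP
    have hder : (dualPoly μ).derivative.IsRoot (a i / b i) := by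
      have : b i ^ (d - 1) * (dualPoly μ).derivative.eval (a i / b i) = 0 := by
        rw [← hx i, dualPoly, Polynomial.derivative_sum, Polynomial.eval_finsetSum,
          Finset.mul_sum]
        refine Finset.sum_congr rfl fun k _ => ?_
        simp only [Polynomial.derivative_C_mul_X_pow, Polynomial.eval_mul, Polynomial.eval_C,
          Polynomial.eval_pow, Polynomial.eval_X, div_pow]
        rcases Nat.eq_zero_or_pos (k : ℕ) with hk | hk
        · simp [hk]
        · have : b i ^ (d - 1) = b i ^ ((k : ℕ) - 1) * b i ^ (d - (k : ℕ)) := by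
            rw [← pow_add]; congr 1; have := k.2; omega
          rw [this]
          field_simp
      exact (mul_eq_zero.1 this).resolve_left (pow_ne_zero _ hi)
    -- Euler's identity turns the two derivative conditions into vanishing of the value.
    have hval : (dualPoly μ).IsRoot (a i / b i) := by
      have : (d : ℝ) * b i ^ d * (dualPoly μ).eval (a i / b i) = 0 := by
        have h1 : (d : ℝ) * b i ^ d * (dualPoly μ).eval (a i / b i) = a i * 0 + b i * 0 := by
          conv_rhs => rw [← hx i]
          nth_rewrite 2 [hx i]
          rw [← hy i, dualPoly, Polynomial.eval_finsetSum, Finset.mul_sum, Finset.mul_sum,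
            Finset.mul_sum, ← Finset.sum_add_distrib]
          refine Finset.sum_congr rfl fun k _ => ?_
          simp only [Polynomial.eval_mul, Polynomial.eval_C,
            Polynomial.eval_pow, Polynomial.eval_X, div_pow]
          have hk : (k : ℕ) ≤ d := Nat.lt_succ_iff.1 k.2
          have e0 : b i ^ d = b i ^ (k : ℕ) * b i ^ (d - (k : ℕ)) := by
            rw [← pow_add]; congr 1; omega
          have e1 : (k : ℕ) * a i ^ (k : ℕ) = a i * ((k : ℕ) * a i ^ ((k : ℕ) - 1)) := by
            rcases Nat.eq_zero_or_pos (k : ℕ) with hk | hk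
            · simp [hk]
            · rw [← Nat.sub_add_cancel hk, pow_succ]; simp; ring
          have e2 : ((d - (k : ℕ) : ℕ) : ℝ) * b i ^ (d - (k : ℕ)) =
              b i * ((d - (k : ℕ) : ℕ) * b i ^ (d - (k : ℕ) - 1)) := by
            rcases Nat.eq_zero_or_pos (d - (k : ℕ)) with hk | hk
            · simp [hk]
            · rw [← Nat.sub_add_cancel hk, pow_succ]; simp; ring
          have e3 : (d : ℝ) = (k : ℕ) + ((d - (k : ℕ) : ℕ) : ℝ) := by
            rw [← Nat.cast_add]; congr 1; omega
          have e4 : (d : ℝ) * b i ^ d * (μ k * d.choose k * (a i ^ (k : ℕ) / b i ^ (k : ℕ))) =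
              d * (μ k * d.choose k * (a i ^ (k : ℕ) * b i ^ (d - (k : ℕ)))) := by
            rw [e0]; field_simp
          rw [e4]
          nth_rewrite 1 [e3]
          linear_combination (μ k * d.choose k * b i ^ (d - (k : ℕ))) * e1 +
            (μ k * d.choose k * a i ^ (k : ℕ)) * e2
        rw [h1]; ring
      exact (mul_eq_zero.1 this).resolve_left
        (mul_ne_zero (Nat.cast_ne_zero.2 hd) (pow_ne_zero _ hi))
    exact (Polynomial.one_lt_rootMultiplicity_iff_isRoot hP).2 ⟨hval, hder⟩
  by_contra hP
  have hcard : ∀ s : Finset (Fin m), (∀ i ∈ s, b i ≠ 0) → 2 * s.card ≤ (dualPoly μ).natDegree := by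
    intro s hs
    have hinj : Set.InjOn (fun i => a i / b i) s := by
      intro i hi j hj hij
      by_contra hne
      have h1 := hs i hi
      have h2 := hs j hj
      apply hab i j hne
      simp only at hij
      rwa [div_eq_div_iff h1 h2] at hij
    rw [← Finset.card_image_of_injOn hinj]
    refine le_trans ?_ (Polynomial.card_roots' _)
    have hle : 2 • (s.image fun i => a i / b i).val ≤ (dualPoly μ).roots := by
      rw [Multiset.le_iff_count]
      intro t
      rw [Multiset.count_nsmul, Polynomial.count_roots]
      by_cases ht : t ∈ s.image fun i => a i / b i
      · obtain ⟨i, hi, rfl⟩ := Finset.mem_image.1 ht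
        rw [Multiset.count_eq_one_of_mem (Finset.nodup _) ht]
        exact hroot i (hs i hi) hP
      · rw [Multiset.count_eq_zero_of_notMem ht]; simp
    have := Multiset.card_le_card hle
    rwa [Multiset.card_nsmul] at this
  by_cases hb : ∃ i, b i = 0
  · obtain ⟨i, hi⟩ := hb
    have hai : a i ≠ 0 := (h0 i).resolve_right (by simpa using hi)
    have h1 := hcard (Finset.univ.erase i) (fun j hj hbj =>
      hab i j (Finset.ne_of_mem_erase hj).symm (by rw [hi, hbj]; simp))
    rw [Finset.card_erase_of_mem (Finset.mem_univ i), Finset.card_univ, Fintype.card_fin] at h1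
    have h2 := natDegree_dualPoly_le μ
    -- The two top coefficients of `dualPoly μ` vanish.
    have c1 : (dualPoly μ).coeff d = 0 := by
      have h3 := hx i
      rw [Finset.sum_eq_single (Fin.last d)] at h3
      · simp [hd, hai] at h3
        have := coeff_dualPoly μ (Fin.last d)
        simpa [h3] using this
      · intro k _ hk
        have : d - (k : ℕ) ≠ 0 := by
          have := Fin.val_lt_last hk
          omega
        simp [hi, this]
      · simp
    have c2 : (dualPoly μ).coeff (d - 1) = 0 := by
      have h3 := hy i
      rw [Finset.sum_eq_single (⟨d - 1, by omega⟩ : Fin (d + 1))] at h3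
      · have e : d - (d - 1) = 1 := by omega
        have := coeff_dualPoly μ ⟨d - 1, by omega⟩
        simp only at this
        rw [this]
        simp only [e] at h3
        simp [hai] at h3
        simpa using h3
      · intro k _ hk
        have hk' : (k : ℕ) ≠ d - 1 := fun h => hk (Fin.ext h)
        rcases Nat.lt_or_ge (k : ℕ) d with h | h
        · have : d - (k : ℕ) - 1 ≠ 0 := by omega
          simp [hi, this]
        · have : d - (k : ℕ) = 0 := by omega
          simp [this]
      · simp
    have c3 : (dualPoly μ).coeff (dualPoly μ).natDegree ≠ 0 :=
      Polynomial.leadingCoeff_ne_zero.2 hP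
    have c4 : (dualPoly μ).natDegree ≠ d := fun h => c3 (by rw [h, c1])
    have c5 : (dualPoly μ).natDegree ≠ d - 1 := fun h => c3 (by rw [h, c2])
    omega
  · push Not at hb
    have h1 := hcard Finset.univ fun i _ => hb i
    have h2 := natDegree_dualPoly_le μ
    rw [Finset.card_univ, Fintype.card_fin] at h1
    omega

/-- A sum of `r + 1` powers that is not a sum of `r` powers is an interior point of the sums of
`r + 1` powers as soon as `d < 2 (r + 1)`: the parametrization by the linear forms, with fixed
coefficients, is a submersion there. -/
lemma mem_interior_powSums {d r : ℕ} (hd : d ≠ 0) (hr : d < 2 * (r + 1)) {v : Fin (d + 1) → ℝ}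
    (h1 : v ∈ powSums d (r + 1)) (h2 : v ∉ powSums d r) : v ∈ interior (powSums d (r + 1)) := by
  obtain ⟨c, a, b, rfl⟩ := h1
  obtain ⟨hc, h0, hab⟩ := nondegenerate_of_notMem_powSums hd h2
  set F : (Fin (r + 1) → ℝ × ℝ) → Fin (d + 1) → ℝ := fun p =>
    ∑ i, c i • powVec d (p i).1 (p i).2
  set F' : (Fin (r + 1) → ℝ × ℝ) →L[ℝ] Fin (d + 1) → ℝ :=
    ∑ i, c i • (powVecDeriv d (a i) (b i)).comp (ContinuousLinearMap.proj i) with hF'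
  have hder : HasStrictFDerivAt F F' fun i => (a i, b i) := by
    refine HasStrictFDerivAt.fun_sum fun i _ => HasStrictFDerivAt.const_smul ?_ (c i)
    exact (hasStrictFDerivAt_powVec d (a i, b i)).comp (fun i => (a i, b i))
      (ContinuousLinearMap.proj (R := ℝ) (φ := fun _ : Fin (r + 1) => ℝ × ℝ) i).hasStrictFDerivAt
  have hsurj : F'.range = ⊤ := by
    by_contra hne
    obtain ⟨φ, hφ, hker⟩ := Submodule.exists_le_ker_of_lt_top _ (lt_top_iff_ne_top.2 hne)
    obtain ⟨μ, hμ⟩ := exists_dual_coeffs φ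
    have hzero : μ = 0 := by
      refine eq_zero_of_sum_mul_powVecDeriv_eq_zero hr hab (fun i x => ?_) hd h0
      have h3 : φ (F' (Pi.single i x)) = 0 := hker ⟨_, rfl⟩
      have h4 : F' (Pi.single i x) = c i • powVecDeriv d (a i) (b i) x := by
        simp only [hF', sum_apply, smul_apply,
          ContinuousLinearMap.comp_apply, ContinuousLinearMap.proj_apply]
        rw [Finset.sum_eq_single i]
        · simp
        · intro j _ hj; simp [Pi.single_eq_of_ne hj]
        · simp
      rw [h4, map_smul, smul_eq_mul, mul_eq_zero] at h3
      rw [← hμ]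
      exact h3.resolve_left (hc i)
    apply hφ
    exact LinearMap.ext fun v => by simp [hμ, hzero]
  rw [mem_interior_iff_mem_nhds]
  have hmap := hder.map_nhds_eq_of_surj hsurj
  change powSums d (r + 1) ∈ nhds (F fun i => (a i, b i))
  rw [← hmap]
  exact Filter.mem_map.2 <| Filter.univ_mem' fun p => ⟨c, fun i => (p i).1, fun i => (p i).2, rfl⟩

/-! ### Typical ranks -/

theorem mainTheorem1 (d m : ℕ) (hlow : (d + 2) / 2 ≤ m) (hup : m ≤ d) :
    IsTypicalRealRank d m := by
  obtain ⟨r, rfl⟩ : ∃ r, m = r + 1 := ⟨m - 1, by omega⟩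
  obtain ⟨u, hu⟩ := exists_notMem_closure_powSums (d := d) (r := r) (by omega)
  have hne : ¬ powSums d (r + 1) ⊆ closure (powSums d r) := fun h =>
    hu (by rw [closure_powSums_eq_univ h]; trivial)
  obtain ⟨v, hv, hv'⟩ := Set.not_subset.1 hne
  exact isTypicalRealRank_of_mem_interior
    (mem_interior_powSums (by omega) (by omega) hv fun h => hv' (subset_closure h)) hv'
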